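/- Let $\mathbb D=\{z\in\mathbb C:|z|<1\}$ and $\mathbb D^*=\mathbb D\setminus\{0\}$. Let $\kappa:\mathbb D\to\mathbb R$ be locally Hölder continuous (every point of $\mathbb D$ has a neighbourhood in $\mathbb D$ on which $\kappa$ is Hölder continuous with some exponent in $(0,1]$) with $\kappa(0)<0$, and let $u:\mathbb D^*\to\mathbb R$ be a $C^2$ solution of $$\Delta u=-\kappa(z)e^{2u}\quad\text{in }\mathbb D^*$$ of order $1$ at the origin, that is, $$\lim_{r\to0^+}\frac{\sup_{|z|=r}u(z)}{\log(1/r)}=1 .$$ Define the remainder function $w:\mathbb D^*\to\mathbb R$ by $$u(z)=-\log|z|-\log\log(1/|z|)+w(z).$$ Then, with $w_{z\bar z}=\frac{\partial}{\partial\bar z}\frac{\partial}{\partial z}w$, $$w_{z\bar z}(z)=O\bigl(|z|^{-2}(\log(1/|z|))^{-3}\bigr)\qquad (z\to0).$$ -/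

import Mathlib

open Set Filter Topology Asymptotics
open scoped NNReal

noncomputable section

/-- The open unit disk. -/
def unitDisk : Set ℂ := Metric.ball 0 1

/-- The punctured open unit disk. -/
def puncturedDisk : Set ℂ := unitDisk \ {0}

/-- `f` is locally Hölder continuous on `s`: every point of `s` has a neighbourhood in `s` on which
`f` is Hölder continuous with some exponent in `(0, 1]`. -/
def LocallyHolderOn (f : ℂ → ℝ) (s : Set ℂ) : Prop :=
  ∀ x ∈ s, ∃ C ν : ℝ≥0, 0 < ν ∧ ν ≤ 1 ∧ ∃ U ∈ 𝓝[s] x, HolderOnWith C ν f U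

/-- `u` is a `C²` solution of `Δ u = -κ e^{2u}` in the punctured unit disk. -/
def IsCurvatureSolution (κ u : ℂ → ℝ) : Prop :=
  ContDiffOn ℝ 2 u puncturedDisk ∧
    ∀ z ∈ puncturedDisk, Laplacian.laplacian u z = -κ z * Real.exp (2 * u z)

/-- `M_u(r) = sup_{|z| = r} u(z)`. -/
def circleSup (u : ℂ → ℝ) (r : ℝ) : ℝ := sSup (u '' Metric.sphere 0 r)

/-- `u` has order `α` at the origin: `M_u(r) / log (1/r) → α` as `r → 0⁺`. -/
def HasOrderAtZero (u : ℂ → ℝ) (α : ℝ) : Prop :=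
  Tendsto (fun r : ℝ => circleSup u r / Real.log (1 / r)) (𝓝[>] 0) (𝓝 α)

/-- The Wirtinger derivative `∂/∂z = (∂/∂x - i ∂/∂y) / 2`. -/
def wirtingerZ (f : ℂ → ℂ) (z : ℂ) : ℂ :=
  (fderiv ℝ f z 1 - Complex.I * fderiv ℝ f z Complex.I) / 2

/-- The Wirtinger derivative `∂/∂z̄ = (∂/∂x + i ∂/∂y) / 2`. -/
def wirtingerZBar (f : ℂ → ℂ) (z : ℂ) : ℂ :=
  (fderiv ℝ f z 1 + Complex.I * fderiv ℝ f z Complex.I) / 2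

/-- The mixed second derivative `w_{z z̄}` of a real-valued function `w`. -/
def mixedDeriv (w : ℂ → ℝ) (z : ℂ) : ℂ :=
  wirtingerZBar (wirtingerZ fun ζ => (w ζ : ℂ)) z

end

/-!
Put `t = -log |z|`. After adding `log |z|` and a constant to `u` one may assume `κ 0 = -1`, and the
resulting `v` solves `Δv = k e^{2v} / |z|²` with `k = 1 + O(|z|^ν)`. Since `-log t` solves the same
equation with `k = 1`, `4 w_{z z̄} = Δw = (k e^{2v} t² - 1) / (|z|² t²)`. So the theorem
is a pointwise estimate on `v`, namely `v = -log t + O(1 / t)`, and no derivative of `w` has to be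
estimated.

This estimate comes from the maximum principle and radial barriers. In the coordinate `t`, the
Laplacian of a radial function is `S''(t) / |z|²` (`laplacian_radial`), and `-log (t - a)` solves
`S'' = e^{2S}`. The correction `∓ D / (t - a)²` turns this solution into a supersolution or a
subsolution for curvature factors `k` with `|k - 1| ≤ D / (t - a)²`, and the further correction
`± ε t`, with `ε → 0`, handles the puncture. The upper bound (`IsCuspSolution.le_neg_log`) only uses
`v ≤ o(t)`, which is half of the hypothesis on the order. The lower bound
(`IsCuspSolution.neg_log_le`) needs `v ≥ -o(t)` at every point, while the order only provides one
such point on each small circle. The gap is closed by Harnack's inequality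
(`superharmonic_le_on_circle`): `-v` is nonnegative by the upper bound, and
`-2 / |z|² ≤ Δ(-v) ≤ 0`, so its maximum on a circle about `0` is bounded by a fixed multiple of its
minimum plus a constant.

Harnack's inequality itself is reduced to the Poisson formula for harmonic functions, by comparing
with the harmonic extension of a trigonometric polynomial close to the boundary values
(`exists_harmonic_near_on_sphere`); this avoids solving the Dirichlet problem.
-/

/-! ### Second derivatives along lines and the Laplacian -/

theorem deriv_deriv_line {E : Type*} [NormedAddCommGroup E] [NormedSpace ℝ E] {f : E → ℝ} {z : E}
    (hf : ContDiffAt ℝ 2 f z) (v : E) :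
    deriv (deriv fun s : ℝ => f (z + s • v)) 0 = iteratedFDeriv ℝ 2 f z ![v, v] := by
  have hline : ∀ s : ℝ, HasDerivAt (fun s : ℝ => z + s • v) v s := fun s => by
    simpa using ((hasDerivAt_id s).smul_const v).const_add z
  have hcont : Tendsto (fun s : ℝ => z + s • v) (𝓝 0) (𝓝 z) := by
    simpa using (hline 0).continuousAt.tendsto
  have hd : deriv (fun s : ℝ => f (z + s • v)) =ᶠ[𝓝 0] fun s => fderiv ℝ f (z + s • v) v := by
    filter_upwards [hcont.eventually (hf.eventually (by simp))] with s hs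
    exact ((hs.differentiableAt (by simp)).hasFDerivAt.comp_hasDerivAt s (hline s)).deriv
  have hf' : DifferentiableAt ℝ (fderiv ℝ f) z :=
    (hf.fderiv_right (m := 1) (by norm_num)).differentiableAt (by simp)
  have hF : HasFDerivAt (fun y => fderiv ℝ f y v)
      ((ContinuousLinearMap.apply ℝ ℝ v).comp (fderiv ℝ (fderiv ℝ f) z)) (z + (0 : ℝ) • v) := by
    rw [zero_smul, add_zero]
    exact (ContinuousLinearMap.apply ℝ ℝ v).hasFDerivAt.comp z hf'.hasFDerivAt
  rw [hd.deriv_eq, iteratedFDeriv_two_apply]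
  exact (hF.comp_hasDerivAt (0 : ℝ) (hline 0)).deriv

theorem laplacian_eq_deriv_deriv {f : ℂ → ℝ} {z : ℂ} (hf : ContDiffAt ℝ 2 f z) :
    Laplacian.laplacian f z = deriv (deriv fun s : ℝ => f (z + s • (1 : ℂ))) 0 +
      deriv (deriv fun s : ℝ => f (z + s • Complex.I)) 0 := by
  rw [InnerProductSpace.laplacian_eq_iteratedFDeriv_complexPlane, deriv_deriv_line hf,
    deriv_deriv_line hf]

theorem deriv_deriv_nonpos_of_isLocalMax {g : ℝ → ℝ} {x : ℝ} (hg : IsLocalMax g x)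
    (hc : ContinuousAt g x) : deriv (deriv g) x ≤ 0 := by
  by_contra! h
  -- A positive second derivative makes `x` a local minimum too, so `g` is locally constant.
  have hmin := isLocalMin_of_deriv_deriv_pos h hg.deriv_eq_zero hc
  have hconst : g =ᶠ[𝓝 x] fun _ => g x := by
    filter_upwards [hg, hmin] with y h1 h2 using le_antisymm h1 h2
  have : deriv (deriv g) x = 0 := by
    rw [hconst.deriv.deriv_eq]; simp
  exact h.ne' this

theorem laplacian_nonpos_of_isLocalMax {f : ℂ → ℝ} {z : ℂ} (hf : ContDiffAt ℝ 2 f z)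
    (hz : IsLocalMax f z) : Laplacian.laplacian f z ≤ 0 := by
  rw [laplacian_eq_deriv_deriv hf]
  have key : ∀ v : ℂ, deriv (deriv fun s : ℝ => f (z + s • v)) 0 ≤ 0 := fun v => by
    have hline : ContinuousAt (fun s : ℝ => z + s • v) 0 := by fun_prop
    have hcont : Tendsto (fun s : ℝ => z + s • v) (𝓝 0) (𝓝 z) := by
      simpa [ContinuousAt] using hline
    apply deriv_deriv_nonpos_of_isLocalMax
    · filter_upwards [hcont.eventually hz] with s hs
      simpa using hs
    · refine ContinuousAt.comp (g := f) ?_ hline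
      simpa using hf.continuousAt
  linarith [key 1, key Complex.I]

/-- The **maximum principle**, in the form used for comparison: a function on a compact set that has
positive Laplacian wherever it is positive, and is nonpositive on the boundary, is nonpositive. -/
theorem nonpos_of_laplacian_pos {K : Set ℂ} (hK : IsCompact K) {f : ℂ → ℝ}
    (hf : ContinuousOn f K)
    (h : ∀ z ∈ K, 0 < f z →
      z ∈ interior K ∧ ContDiffAt ℝ 2 f z ∧ 0 < Laplacian.laplacian f z) :
    ∀ z ∈ K, f z ≤ 0 := by
  intro z hz
  obtain ⟨x, hxK, hx⟩ := hK.exists_isMaxOn ⟨z, hz⟩ hf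
  by_contra! hpos
  obtain ⟨hint, hC, hΔ⟩ := h x hxK (hpos.trans_le (hx hz))
  exact hΔ.not_ge <| laplacian_nonpos_of_isLocalMax hC <|
    hx.isLocalMax (mem_interior_iff_mem_nhds.1 hint)

theorem contDiffAt_log_norm {z : ℂ} (hz : z ≠ 0) :
    ContDiffAt ℝ 2 (fun ζ : ℂ => Real.log ‖ζ‖) z :=
  (contDiffAt_norm ℝ hz).log (norm_ne_zero_iff.2 hz)

theorem contDiffAt_radial {S : ℝ → ℝ} {z : ℂ} (hz : z ≠ 0)
    (hS : ContDiffAt ℝ 2 S (-Real.log ‖z‖)) :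
    ContDiffAt ℝ 2 (fun ζ : ℂ => S (-Real.log ‖ζ‖)) z :=
  ContDiffAt.comp (g := S) z hS (contDiffAt_log_norm hz).neg

theorem deriv_deriv_radial_line {S S' : ℝ → ℝ} {S'' : ℝ} {z v : ℂ} (hz : z ≠ 0)
    (h1 : ∀ᶠ t in 𝓝 (-Real.log ‖z‖), HasDerivAt S (S' t) t)
    (h2 : HasDerivAt S' S'' (-Real.log ‖z‖)) :
    deriv (deriv fun s : ℝ => S (-Real.log ‖z + s • v‖)) 0 =
      S'' * (z.re * v.re + z.im * v.im) ^ 2 / ‖z‖ ^ 4 -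
        S' (-Real.log ‖z‖) * (‖v‖ ^ 2 * ‖z‖ ^ 2 - 2 * (z.re * v.re + z.im * v.im) ^ 2)
          / ‖z‖ ^ 4 := by
  set B := z.re * v.re + z.im * v.im with hB
  set A := ‖z‖ ^ 2 with hA
  have hA0 : A ≠ 0 := by simpa [hA] using hz
  set n : ℝ → ℝ := fun s => A + 2 * B * s + ‖v‖ ^ 2 * s ^ 2 with hn
  have hnorm : ∀ s : ℝ, ‖z + s • v‖ ^ 2 = n s := fun s => by
    simp only [hn, hA, hB, Complex.sq_norm, Complex.normSq_apply, Complex.add_re, Complex.add_im,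
      Complex.real_smul, Complex.re_ofReal_mul, Complex.im_ofReal_mul]
    ring
  have hlog : ∀ s : ℝ, -Real.log ‖z + s • v‖ = -(Real.log (n s) / 2) := fun s => by
    rw [← hnorm, Real.log_pow]; push_cast; ring
  have hn' : ∀ s, HasDerivAt n (2 * B + ‖v‖ ^ 2 * (2 * s)) s := fun s => by
    exact ((((hasDerivAt_id' s).const_mul (2 * B)).const_add A).fun_add
      (((hasDerivAt_id' s).fun_pow 2).const_mul (‖v‖ ^ 2))).congr_deriv (by push_cast; ring)
  have hn0 : n 0 = A := by simp [hn]
  have hlog0 : -(Real.log (n 0) / 2) = -Real.log ‖z‖ := by rw [← hlog]; simp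
  have hne : ∀ᶠ s in 𝓝 (0 : ℝ), n s ≠ 0 :=
    (hn' 0).continuousAt.eventually_ne (by rwa [hn0])
  set q : ℝ → ℝ := fun s => -((2 * B + ‖v‖ ^ 2 * (2 * s)) / n s / 2) with hq
  have hl' : ∀ s, n s ≠ 0 → HasDerivAt (fun s => -(Real.log (n s) / 2)) (q s) s :=
    fun s hs => (((hn' s).log hs).div_const 2).neg
  have hT : Tendsto (fun s => -(Real.log (n s) / 2)) (𝓝 0) (𝓝 (-Real.log ‖z‖)) := by
    have := (hl' 0 (by rwa [hn0])).continuousAt.tendsto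
    rwa [hlog0] at this
  simp only [hlog]
  have hd : deriv (fun s : ℝ => S (-(Real.log (n s) / 2))) =ᶠ[𝓝 0]
      fun s => S' (-(Real.log (n s) / 2)) * q s := by
    filter_upwards [hT.eventually h1, hne] with s hs hns
    exact (HasDerivAt.comp (h₂ := S) s hs (hl' s hns)).deriv
  have hq' : HasDerivAt q (-(((‖v‖ ^ 2 * 2) * A - 2 * B * (2 * B)) / A ^ 2 / 2)) 0 := by
    have hnum : HasDerivAt (fun s : ℝ => 2 * B + ‖v‖ ^ 2 * (2 * s)) (‖v‖ ^ 2 * 2) 0 := by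
      simpa using ((((hasDerivAt_id (0 : ℝ)).const_mul 2).const_mul (‖v‖ ^ 2)).const_add (2 * B))
    have := ((hnum.fun_div (hn' 0) (by rwa [hn0])).div_const 2).fun_neg
    simpa [hn0] using this
  have hS' : HasDerivAt (fun s => S' (-(Real.log (n s) / 2))) (S'' * q 0) 0 :=
    HasDerivAt.comp (h₂ := S') (0 : ℝ) (by rwa [hlog0]) (hl' 0 (by rwa [hn0]))
  rw [hd.deriv_eq, (hS'.fun_mul hq').deriv, hlog0]
  have hA4 : ‖z‖ ^ 4 = A ^ 2 := by rw [hA]; ring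
  rw [hA4]
  simp only [hq, hn0]
  field_simp
  ring

/-- In the coordinate `t = -log |z|` the Laplacian of a radial function is `S''(t) / |z|²`. -/
theorem laplacian_radial {S S' : ℝ → ℝ} {S'' : ℝ} {z : ℂ} (hz : z ≠ 0)
    (hS : ContDiffAt ℝ 2 S (-Real.log ‖z‖))
    (h1 : ∀ᶠ t in 𝓝 (-Real.log ‖z‖), HasDerivAt S (S' t) t)
    (h2 : HasDerivAt S' S'' (-Real.log ‖z‖)) :
    Laplacian.laplacian (fun ζ : ℂ => S (-Real.log ‖ζ‖)) z = S'' / ‖z‖ ^ 2 := by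
  rw [laplacian_eq_deriv_deriv (contDiffAt_radial hz hS), deriv_deriv_radial_line hz h1 h2,
    deriv_deriv_radial_line hz h1 h2]
  have hz' : ‖z‖ ≠ 0 := norm_ne_zero_iff.2 hz
  have hsq : ‖z‖ ^ 2 = z.re ^ 2 + z.im ^ 2 := by
    rw [Complex.sq_norm, Complex.normSq_apply]; ring
  simp only [Complex.one_re, Complex.one_im, Complex.I_re, Complex.I_im, norm_one, Complex.norm_I]
  field_simp
  rw [hsq]
  ring

theorem laplacian_norm_sub_sq (c z : ℂ) :
    Laplacian.laplacian (fun ζ : ℂ => ‖ζ - c‖ ^ 2) z = 4 := by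
  have hC : ContDiffAt ℝ 2 (fun ζ : ℂ => ‖ζ - c‖ ^ 2) z :=
    ((contDiff_norm_sq ℝ).comp (contDiff_id.sub contDiff_const)).contDiffAt
  rw [laplacian_eq_deriv_deriv hC]
  have key : ∀ v : ℂ, deriv (deriv fun s : ℝ => ‖z + s • v - c‖ ^ 2) 0 = 2 * ‖v‖ ^ 2 := fun v => by
    have h : (fun s : ℝ => ‖z + s • v - c‖ ^ 2) = fun s =>
        ‖z - c‖ ^ 2 + 2 * ((z - c).re * v.re + (z - c).im * v.im) * s + ‖v‖ ^ 2 * s ^ 2 := by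
      ext s
      simp only [Complex.sq_norm, Complex.normSq_apply, Complex.add_re, Complex.add_im,
        Complex.sub_re, Complex.sub_im,
        Complex.real_smul, Complex.re_ofReal_mul, Complex.im_ofReal_mul]
      ring
    have h' : deriv (fun s : ℝ => ‖z + s • v - c‖ ^ 2) = fun s =>
        2 * ((z - c).re * v.re + (z - c).im * v.im) + ‖v‖ ^ 2 * (2 * s) := by
      ext s
      rw [h]
      refine HasDerivAt.deriv ?_
      convert (((hasDerivAt_id' s).const_mul
        (2 * ((z - c).re * v.re + (z - c).im * v.im))).const_add (‖z - c‖ ^ 2)).fun_add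
        (((hasDerivAt_id' s).fun_pow 2).const_mul (‖v‖ ^ 2)) using 1
      norm_num
    rw [h']
    refine HasDerivAt.deriv ?_
    convert (((hasDerivAt_id' (0 : ℝ)).const_mul 2).const_mul (‖v‖ ^ 2)).const_add
      (2 * ((z - c).re * v.re + (z - c).im * v.im)) using 1
    ring
  rw [key, key]
  norm_num

theorem mixedDeriv_eq_laplacian {w : ℂ → ℝ} {z : ℂ} (hw : ContDiffAt ℝ 2 w z) :
    mixedDeriv w z = ((Laplacian.laplacian w z / 4 : ℝ) : ℂ) := by
  have hD : DifferentiableAt ℝ (fderiv ℝ w) z :=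
    (hw.fderiv_right (m := 1) (by norm_num)).differentiableAt (by simp)
  have hfd : (fun ζ => fderiv ℝ (fun ζ => (w ζ : ℂ)) ζ) =ᶠ[𝓝 z]
      fun ζ => Complex.ofRealCLM.comp (fderiv ℝ w ζ) := by
    filter_upwards [hw.eventually (by simp)] with ζ hζ
    exact (Complex.ofRealCLM.hasFDerivAt.comp ζ
      (hζ.differentiableAt (by simp)).hasFDerivAt).fderiv
  have hz : wirtingerZ (fun ζ => (w ζ : ℂ)) =ᶠ[𝓝 z] fun ζ =>
      ((fderiv ℝ w ζ 1 : ℝ) - Complex.I * (fderiv ℝ w ζ Complex.I : ℝ)) / 2 := by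
    filter_upwards [hfd] with ζ hζ
    simp [wirtingerZ, hζ]
  have hv : ∀ v : ℂ, HasFDerivAt (fun ζ => ((fderiv ℝ w ζ v : ℝ) : ℂ))
      (Complex.ofRealCLM.comp ((ContinuousLinearMap.apply ℝ ℝ v).comp
        (fderiv ℝ (fderiv ℝ w) z))) z := fun v =>
    Complex.ofRealCLM.hasFDerivAt.comp z
      ((ContinuousLinearMap.apply ℝ ℝ v).hasFDerivAt.comp z hD.hasFDerivAt)
  have hW := ((hv 1).fun_sub ((hv Complex.I).const_mul Complex.I)).mul_const (2⁻¹ : ℂ)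
  have hsymm := (hw.isSymmSndFDerivAt (by simp)).eq 1 Complex.I
  rw [mixedDeriv, wirtingerZBar, hz.fderiv_eq]
  simp only [div_eq_mul_inv]
  rw [hW.fderiv, InnerProductSpace.laplacian_eq_iteratedFDeriv_complexPlane]
  simp only [iteratedFDeriv_two_apply]
  simp [hsymm]
  ring_nf
  simp
  ring

/-! ### Harnack inequality for superharmonic functions with bounded Laplacian -/

open InnerProductSpace in
theorem exists_harmonic_of_mem_span_fourier (c : ℂ) {R : ℝ} (hR : R ≠ 0)
    {F : C(AddCircle (2 * Real.pi), ℂ)} (hF : F ∈ Submodule.span ℂ (range fourier)) :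
    ∃ H : ℂ → ℂ, (∀ z, HarmonicAt H z) ∧ ∀ x, H (c + R * AddCircle.toCircle x) = F x := by
  have hR' : (R : ℂ) ≠ 0 := by exact_mod_cast hR
  induction hF using Submodule.span_induction with
  | mem F hF =>
    obtain ⟨n, rfl⟩ := hF
    have han : ∀ (k : ℕ) z, AnalyticAt ℂ (fun z : ℂ => ((z - c) / R) ^ k) z := fun k z => by
      fun_prop (disch := assumption)
    have hval : ∀ (k : ℕ) (x : AddCircle (2 * Real.pi)),
        ((c + R * (AddCircle.toCircle x : ℂ) - c) / R) ^ k = fourier (k : ℤ) x := fun k x => by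
      rw [fourier_apply, add_sub_cancel_left, mul_div_cancel_left₀ _ hR', natCast_zsmul,
        AddCircle.toCircle_nsmul]
      simp
    obtain ⟨k, rfl | rfl⟩ := n.eq_nat_or_neg
    · exact ⟨_, fun z => (han k z).harmonicAt, hval k⟩
    · refine ⟨_, fun z => (han k z).harmonicAt_conj, fun x => ?_⟩
      rw [fourier_neg, ← hval k]
      rfl
  | zero => exact ⟨fun _ => 0, fun z => harmonicAt_const 0, fun x => rfl⟩
  | add F G _ _ hF hG =>
    obtain ⟨H₁, h₁, e₁⟩ := hF
    obtain ⟨H₂, h₂, e₂⟩ := hG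
    exact ⟨H₁ + H₂, fun z => (h₁ z).add (h₂ z), fun x => by simp [e₁, e₂]⟩
  | smul a F _ hF =>
    obtain ⟨H, h, e⟩ := hF
    refine ⟨_, fun z => (h z).comp_CLM ((a • ContinuousLinearMap.id ℂ ℂ).restrictScalars ℝ),
      fun x => ?_⟩
    simp [e]

open InnerProductSpace in
/-- Trigonometric polynomials are uniformly dense among the continuous functions on a circle, and
they extend to harmonic functions on the plane. -/
theorem exists_harmonic_near_on_sphere (c : ℂ) {R : ℝ} (hR : 0 < R) {g : ℂ → ℝ}
    (hg : ContinuousOn g (Metric.sphere c R)) {ε : ℝ} (hε : 0 < ε) :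
    ∃ h : ℂ → ℝ, (∀ z, HarmonicAt h z) ∧ ∀ z ∈ Metric.sphere c R, |h z - g z| ≤ ε := by
  have : Fact (0 < 2 * Real.pi) := ⟨Real.two_pi_pos⟩
  have hmem : ∀ x : AddCircle (2 * Real.pi),
      c + R * (AddCircle.toCircle x : ℂ) ∈ Metric.sphere c R := fun x => by
    rw [mem_sphere_iff_norm, add_sub_cancel_left, norm_mul, Circle.norm_coe, mul_one,
      Complex.norm_real, Real.norm_of_nonneg hR.le]
  have hcont : Continuous fun x : AddCircle (2 * Real.pi) =>
      ((g (c + R * (AddCircle.toCircle x : ℂ)) : ℝ) : ℂ) := by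
    refine Complex.continuous_ofReal.comp (hg.comp_continuous ?_ hmem)
    have := (AddCircle.continuous_toCircle (T := 2 * Real.pi))
    fun_prop
  let G : C(AddCircle (2 * Real.pi), ℂ) := ⟨_, hcont⟩
  have hG : G ∈ closure (Submodule.span ℂ (range (fourier (T := 2 * Real.pi))) : Set _) := by
    rw [← Submodule.topologicalClosure_coe, span_fourier_closure_eq_top]
    trivial
  obtain ⟨F, hF, hGF⟩ := Metric.mem_closure_iff.1 hG ε hε
  obtain ⟨H, hH, hHF⟩ := exists_harmonic_of_mem_span_fourier c hR.ne' hF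
  refine ⟨_, fun z => (hH z).comp_CLM Complex.reCLM, fun z hz => ?_⟩
  obtain ⟨x, rfl⟩ : ∃ x : AddCircle (2 * Real.pi), c + R * (AddCircle.toCircle x : ℂ) = z := by
    refine ⟨((z - c).arg : ℝ), ?_⟩
    have hz' : ‖z - c‖ = R := by simpa [dist_eq_norm] using hz
    have := Complex.norm_mul_exp_arg_mul_I (z - c)
    rw [hz'] at this
    rw [AddCircle.toCircle_apply_mk, div_self Real.two_pi_pos.ne', one_mul, Circle.coe_exp, this]
    ring
  have h1 : ‖F x - G x‖ ≤ ε := by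
    rw [← dist_eq_norm, dist_comm]
    exact (ContinuousMap.dist_apply_le_dist x).trans hGF.le
  have h2 : Complex.reCLM (H (c + R * (AddCircle.toCircle x : ℂ))) - g (c + R * (AddCircle.toCircle x : ℂ))
      = (F x - G x).re := by
    rw [hHF]; simp [G]
  rw [Function.comp_apply, h2]
  exact (Complex.abs_re_le_norm _).trans h1

/-- **Harnack inequality** for nonnegative harmonic functions, comparing with the value at the
centre: it follows from the lower bound `1 / 3` for the Poisson kernel on the half-size disc. -/
theorem harmonic_center_le_three_mul {c : ℂ} {R : ℝ} (hR : 0 < R) {h : ℂ → ℝ}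
    (hh : ∀ z, InnerProductSpace.HarmonicAt h z) (hpos : ∀ z ∈ Metric.sphere c R, 0 ≤ h z)
    {z : ℂ} (hz : ‖z - c‖ ≤ R / 2) : h c ≤ 3 * h z := by
  have hzb : z ∈ Metric.ball c R := by
    rw [mem_ball_iff_norm]; linarith
  have hH : InnerProductSpace.HarmonicOnNhd h (Metric.closedBall c R) := fun x _ => hh x
  have hcont : Continuous h := continuous_iff_continuousAt.2 fun x => (hh x).1.continuousAt
  have e1 : Real.circleAverage h c R = h c :=
    InnerProductSpace.HarmonicOnNhd.circleAverage_eq (by rwa [abs_of_pos hR])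
  have e2 := hH.circleAverage_re_herglotzRieszKernel_smul hzb
  have hint : CircleIntegrable ((Complex.re ∘ herglotzRieszKernel c z) • h) c R := by
    apply ContinuousOn.circleIntegrable'
    exact (Complex.continuous_re.comp_continuousOn
      (continuousOn_herglotzRieszKernel_sphere hzb)).smul hcont.continuousOn
  have hle : Real.circleAverage ((1 / 3 : ℝ) • h) c R ≤ h z := by
    rw [← e2]
    refine Real.circleAverage_mono
      (hcont.const_smul (1 / 3 : ℝ)).continuousOn.circleIntegrable' hint fun x hx => ?_
    rw [abs_of_pos hR] at hx
    have hk := le_re_herglotzRieszKernel hx hzb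
    have h3 : (1 / 3 : ℝ) ≤ (R - ‖z - c‖) / (R + ‖z - c‖) := by
      rw [div_le_div_iff₀ (by norm_num) (by positivity)]
      linarith
    exact mul_le_mul_of_nonneg_right (h3.trans hk) (hpos x hx)
  rw [Real.circleAverage_smul, e1, smul_eq_mul] at hle
  linarith

/-- Harnack inequality at the centre of a disc for a nonnegative function `N` with
`-C ≤ ΔN ≤ 0`. By the maximum principle `N` differs by at most `C R² / 4` from the harmonic function
with the same boundary values. -/
theorem superharmonic_center_le {c : ℂ} {R C : ℝ} (hR : 0 < R) {N : ℂ → ℝ}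
    (hN : ∀ z ∈ Metric.closedBall c R, ContDiffAt ℝ 2 N z)
    (hpos : ∀ z ∈ Metric.closedBall c R, 0 ≤ N z)
    (hle : ∀ z ∈ Metric.closedBall c R, Laplacian.laplacian N z ≤ 0)
    (hge : ∀ z ∈ Metric.closedBall c R, -C ≤ Laplacian.laplacian N z)
    {z : ℂ} (hz : ‖z - c‖ ≤ R / 2) : N c ≤ 3 * N z + C * R ^ 2 / 4 := by
  have hsub := Metric.sphere_subset_closedBall (x := c) (ε := R)
  have hcont : ContinuousOn N (Metric.closedBall c R) := fun x hx =>
    (hN x hx).continuousAt.continuousWithinAt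
  have hq : ∀ x, ContDiffAt ℝ 2 (fun ζ : ℂ => ‖ζ - c‖ ^ 2 - R ^ 2) x := fun x =>
    (((contDiff_norm_sq ℝ).comp (contDiff_id.sub contDiff_const)).sub contDiff_const).contDiffAt
  have hΔq : ∀ x, Laplacian.laplacian (fun ζ : ℂ => ‖ζ - c‖ ^ 2 - R ^ 2) x = 4 := fun x => by
    have := ContDiffAt.laplacian_sub (x := x) (f₁ := fun ζ : ℂ => ‖ζ - c‖ ^ 2)
      (f₂ := fun _ : ℂ => R ^ 2)
      ((contDiff_norm_sq ℝ).comp (contDiff_id.sub contDiff_const)).contDiffAt contDiffAt_const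
    rw [laplacian_norm_sub_sq, InnerProductSpace.laplacian_const] at this
    exact this.trans (sub_zero 4)
  -- It suffices to prove the inequality up to an error that is linear in `ε`.
  suffices key : ∀ ε > 0, N c ≤ 3 * N z + C * R ^ 2 / 4 + (6 + 4 * R ^ 2) * ε by
    refine le_of_forall_pos_le_add fun η hη => ?_
    have h6 : 0 < 6 + 4 * R ^ 2 := by positivity
    have := key (η / (6 + 4 * R ^ 2)) (by positivity)
    rwa [mul_div_cancel₀ _ h6.ne'] at this
  intro ε hε
  obtain ⟨h, hh, hhN⟩ := exists_harmonic_near_on_sphere c hR (hcont.mono hsub) hε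
  have hhcont : Continuous h := continuous_iff_continuousAt.2 fun x => (hh x).1.continuousAt
  have hΔh : ∀ x, Laplacian.laplacian h x = 0 := fun x => (hh x).2.self_of_nhds
  have hharn : h c + ε ≤ 3 * (h z + ε) := by
    refine harmonic_center_le_three_mul hR (h := h + fun _ => ε)
      (fun x => (hh x).add (InnerProductSpace.harmonicAt_const ε)) (fun x hx => ?_) hz
    have := abs_le.1 (hhN x hx)
    have := hpos x (hsub hx)
    simp only [Pi.add_apply]
    linarith
  have hint : ∀ x ∈ Metric.closedBall c R, x ∉ Metric.sphere c R →
      x ∈ interior (Metric.closedBall c R) := fun x hx hx' => by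
    rw [interior_closedBall c hR.ne']
    exact lt_of_le_of_ne hx hx'
  -- Comparison from above and from below, each with a positive multiple of `‖ζ - c‖² - R²` added
  -- to make the Laplacian strictly positive.
  have hup := nonpos_of_laplacian_pos (isCompact_closedBall c R)
    (f := (N - h) + (C / 4 + ε) • (fun ζ : ℂ => ‖ζ - c‖ ^ 2 - R ^ 2) - fun _ => ε)
    (by fun_prop) (fun x hx hfx => by
      have hNx := hN x hx
      have h1 : ContDiffAt ℝ 2 ((N - h) + (C / 4 + ε) • (fun ζ : ℂ => ‖ζ - c‖ ^ 2 - R ^ 2)) x :=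
        ContDiffAt.add (f := N - h) (hNx.sub (hh x).1) ((hq x).const_smul (C / 4 + ε))
      refine ⟨hint x hx fun hxs => ?_, h1.sub contDiffAt_const, ?_⟩
      · have h2 := abs_le.1 (hhN x hxs)
        have h3 : ‖x - c‖ = R := by simpa [dist_eq_norm] using hxs
        simp [h3] at hfx
        linarith
      · rw [h1.laplacian_sub contDiffAt_const, ContDiffAt.laplacian_add (f₁ := N - h)
          (f₂ := (C / 4 + ε) • fun ζ : ℂ => ‖ζ - c‖ ^ 2 - R ^ 2) (hNx.sub (hh x).1)
          ((hq x).const_smul (C / 4 + ε)), hNx.laplacian_sub (hh x).1,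
          InnerProductSpace.laplacian_smul _ (hq x), hΔq, hΔh, InnerProductSpace.laplacian_const]
        have := hge x hx
        simp only [smul_eq_mul, Pi.zero_apply]
        linarith) c (Metric.mem_closedBall_self hR.le)
  have hlow := nonpos_of_laplacian_pos (isCompact_closedBall c R)
    (f := (h - N) + ε • (fun ζ : ℂ => ‖ζ - c‖ ^ 2 - R ^ 2) - fun _ => ε)
    (by fun_prop) (fun x hx hfx => by
      have hNx := hN x hx
      have h1 : ContDiffAt ℝ 2 ((h - N) + ε • (fun ζ : ℂ => ‖ζ - c‖ ^ 2 - R ^ 2)) x :=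
        ContDiffAt.add (f := h - N) ((hh x).1.sub hNx) ((hq x).const_smul ε)
      refine ⟨hint x hx fun hxs => ?_, h1.sub contDiffAt_const, ?_⟩
      · have h2 := abs_le.1 (hhN x hxs)
        have h3 : ‖x - c‖ = R := by simpa [dist_eq_norm] using hxs
        simp [h3] at hfx
        linarith
      · rw [h1.laplacian_sub contDiffAt_const, ContDiffAt.laplacian_add (f₁ := h - N)
          (f₂ := ε • fun ζ : ℂ => ‖ζ - c‖ ^ 2 - R ^ 2) ((hh x).1.sub hNx)
          ((hq x).const_smul ε), (hh x).1.laplacian_sub hNx,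
          InnerProductSpace.laplacian_smul _ (hq x), hΔq, hΔh, InnerProductSpace.laplacian_const]
        have := hle x hx
        simp only [smul_eq_mul, Pi.zero_apply]
        linarith) z (by rw [mem_closedBall_iff_norm]; linarith)
  simp only [Pi.sub_apply, Pi.add_apply, Pi.smul_apply, smul_eq_mul, sub_self, norm_zero] at hup hlow
  nlinarith [mul_nonneg hε.le (sq_nonneg ‖z - c‖)]

/-- Harnack inequality on a circle about the origin, for functions with `-B / |z|² ≤ ΔN ≤ 0`: the
bound is invariant under scaling, so the constant does not depend on the radius. It comes from
chaining thirteen discs along the circle. -/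
theorem superharmonic_le_on_circle {r B : ℝ} (hr : 0 < r) (hB : 0 ≤ B) {N : ℂ → ℝ}
    (hN : ∀ z : ℂ, r / 2 ≤ ‖z‖ → ‖z‖ ≤ 3 / 2 * r → ContDiffAt ℝ 2 N z ∧ 0 ≤ N z ∧
      Laplacian.laplacian N z ≤ 0 ∧ -(B / ‖z‖ ^ 2) ≤ Laplacian.laplacian N z)
    {z₁ z₂ : ℂ} (h₁ : ‖z₁‖ = r) (h₂ : ‖z₂‖ = r) : N z₁ ≤ 3 ^ 13 * (N z₂ + B) := by
  have step : ∀ a b : ℂ, ‖a‖ = r → ‖b - a‖ ≤ r / 4 → N a + B ≤ 3 * (N b + B) := by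
    intro a b ha hb
    have hmem : ∀ z ∈ Metric.closedBall a (r / 2), r / 2 ≤ ‖z‖ ∧ ‖z‖ ≤ 3 / 2 * r := by
      intro z hz
      rw [mem_closedBall_iff_norm] at hz
      have h1 := norm_sub_norm_le z a
      have h2 := norm_sub_norm_le a z
      rw [norm_sub_rev] at h2
      constructor <;> linarith
    have := superharmonic_center_le (c := a) (R := r / 2) (C := 4 * B / r ^ 2) (z := b) (N := N)
      (by positivity) (fun z hz => (hN z (hmem z hz).1 (hmem z hz).2).1)
      (fun z hz => (hN z (hmem z hz).1 (hmem z hz).2).2.1)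
      (fun z hz => (hN z (hmem z hz).1 (hmem z hz).2).2.2.1)
      (fun z hz => by
        refine le_trans (neg_le_neg ?_) (hN z (hmem z hz).1 (hmem z hz).2).2.2.2
        rw [show 4 * B / r ^ 2 = B / (r / 2) ^ 2 by field_simp; ring]
        gcongr
        exact (hmem z hz).1) (by linarith)
    have e : 4 * B / r ^ 2 * (r / 2) ^ 2 / 4 = B / 4 := by field_simp; ring
    rw [e] at this
    linarith
  -- The points of the chain are `z₁ e^{i j δ}` with `δ = arg (z₂ / z₁) / 13`, and `π / 13 < 1 / 4`.
  set δ : ℝ := (z₂ / z₁).arg / 13 with hδ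
  have hz₁ : z₁ ≠ 0 := by rw [← norm_ne_zero_iff, h₁]; exact hr.ne'
  have hδ' : |δ| ≤ 1 / 4 := by
    rw [hδ, abs_div, abs_of_pos (by norm_num : (0 : ℝ) < 13)]
    have := Complex.abs_arg_le_pi (z₂ / z₁)
    have := Real.pi_lt_d2
    linarith
  set p : ℕ → ℂ := fun j => z₁ * Complex.exp (((j * δ : ℝ) : ℂ) * Complex.I) with hp
  have hpn : ∀ j, ‖p j‖ = r := fun j => by
    simp only [hp, norm_mul, Complex.norm_exp_ofReal_mul_I, mul_one, h₁]
  have hps : ∀ j, ‖p (j + 1) - p j‖ ≤ r / 4 := fun j => by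
    have e : p (j + 1) - p j = p j * (Complex.exp (Complex.I * δ) - 1) := by
      simp only [hp]
      rw [mul_sub, mul_one, mul_assoc, ← Complex.exp_add]
      congr 3
      push_cast
      ring
    rw [e, norm_mul, hpn]
    have := Real.norm_exp_I_mul_ofReal_sub_one_le (x := δ)
    rw [Real.norm_eq_abs] at this
    nlinarith
  have hchain : ∀ j : ℕ, N z₁ + B ≤ 3 ^ j * (N (p j) + B) := by
    intro j
    induction j with
    | zero => simp [hp]
    | succ j ih =>
      have := step (p j) (p (j + 1)) (hpn j) (hps j)
      calc N z₁ + B ≤ 3 ^ j * (N (p j) + B) := ih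
        _ ≤ 3 ^ j * (3 * (N (p (j + 1)) + B)) := by gcongr
        _ = _ := by ring
  have hend : p 13 = z₂ := by
    have h1 : ‖z₂ / z₁‖ = 1 := by rw [norm_div, h₁, h₂, div_self hr.ne']
    have h2 := Complex.norm_mul_exp_arg_mul_I (z₂ / z₁)
    rw [h1, Complex.ofReal_one, one_mul] at h2
    simp only [hp, hδ]
    rw [show ((13 : ℕ) : ℝ) * ((z₂ / z₁).arg / 13) = (z₂ / z₁).arg by push_cast; ring, h2]
    field_simp
  have := hchain 13
  rw [hend] at this
  linarith

/-! ### Comparison with radial barriers at the puncture -/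

theorem tendsto_neg_log_norm : Tendsto (fun z : ℂ => -Real.log ‖z‖) (𝓝[≠] 0) atTop :=
  tendsto_neg_atBot_atTop.comp (Real.tendsto_log_nhdsGT_zero.comp tendsto_norm_nhdsNE_zero)

/-- The maximum principle on a punctured disc, for a function that is nonpositive near the
puncture. -/
theorem nonpos_of_laplacian_pos_punctured {ρ : ℝ} {f : ℂ → ℝ}
    (hf : ∀ z : ℂ, 0 < ‖z‖ → ‖z‖ ≤ ρ → ContDiffAt ℝ 2 f z)
    (hb : ∀ z : ℂ, ‖z‖ = ρ → f z ≤ 0) (h0 : ∀ᶠ z in 𝓝[≠] (0 : ℂ), f z ≤ 0)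
    (hΔ : ∀ z : ℂ, 0 < ‖z‖ → ‖z‖ ≤ ρ → 0 < f z → 0 < Laplacian.laplacian f z)
    {z : ℂ} (hz : 0 < ‖z‖) (hzρ : ‖z‖ ≤ ρ) : f z ≤ 0 := by
  obtain ⟨δ, hδ, hδf⟩ := Metric.eventually_nhds_iff.1 (eventually_nhdsWithin_iff.1 h0)
  have hsmall : ∀ x : ℂ, 0 < ‖x‖ → 0 < f x → δ ≤ ‖x‖ := fun x hx hfx => by
    by_contra! hlt
    exact hfx.not_ge (hδf (by simpa using hlt) (by simpa using hx))
  by_contra! hfz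
  set K : Set ℂ := Metric.closedBall 0 ρ ∩ (Metric.ball 0 (δ / 2))ᶜ with hK
  have hmemK : ∀ x : ℂ, x ∈ K ↔ ‖x‖ ≤ ρ ∧ δ / 2 ≤ ‖x‖ := fun x => by simp [hK]
  have hKc : IsCompact K := (isCompact_closedBall 0 ρ).inter_right Metric.isOpen_ball.isClosed_compl
  refine hfz.not_ge <| nonpos_of_laplacian_pos hKc
    (fun x hx => (hf x (by linarith [((hmemK x).1 hx).2])
      ((hmemK x).1 hx).1).continuousAt.continuousWithinAt) (fun x hx hfx => ?_) z
    ((hmemK z).2 ⟨hzρ, by linarith [hsmall z hz hfz]⟩)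
  obtain ⟨h1, h2⟩ := (hmemK x).1 hx
  have hx0 : 0 < ‖x‖ := by linarith
  refine ⟨?_, hf x hx0 h1, hΔ x hx0 h1 hfx⟩
  have hlt : ‖x‖ < ρ := lt_of_le_of_ne h1 fun h => hfx.not_ge (hb x h)
  have hgt : δ / 2 < ‖x‖ := by linarith [hsmall x hx0 hfx]
  rw [mem_interior_iff_mem_nhds]
  filter_upwards [continuous_norm.continuousAt.eventually_lt_const hlt,
    continuous_norm.continuousAt.eventually_const_lt hgt] with y hy1 hy2
  exact (hmemK y).2 ⟨hy1.le, hy2.le⟩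

/-- The family of radial barriers, in the coordinate `t = -log |z|`. With `d = e = 0` it is a solution
of `S'' = exp (2 S)`, that is, a hyperbolic metric with a cusp at the origin; `d / (t - a) ^ 2`
absorbs a perturbation of the curvature, and `e * t` a logarithmic pole. -/
noncomputable def cuspBarrier (a d e t : ℝ) : ℝ := -Real.log (t - a) + d / (t - a) ^ 2 + e * t

theorem hasDerivAt_cuspBarrier (a d e : ℝ) {t : ℝ} (ht : a < t) :
    HasDerivAt (cuspBarrier a d e) (-(t - a)⁻¹ - 2 * d / (t - a) ^ 3 + e) t := by
  have hs : t - a ≠ 0 := (sub_pos.2 ht).ne'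
  have h1 : HasDerivAt (fun t => t - a) 1 t := (hasDerivAt_id' t).sub_const a
  have h2 := (((h1.log hs).fun_neg).fun_add
    ((hasDerivAt_const t d).fun_div (h1.fun_pow 2) (pow_ne_zero 2 hs))).fun_add
    ((hasDerivAt_id' t).const_mul e)
  refine h2.congr_deriv ?_
  push_cast
  field_simp
  ring

theorem hasDerivAt_deriv_cuspBarrier (a d e : ℝ) {t : ℝ} (ht : a < t) :
    HasDerivAt (fun t => -(t - a)⁻¹ - 2 * d / (t - a) ^ 3 + e)
      (1 / (t - a) ^ 2 + 6 * d / (t - a) ^ 4) t := by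
  have hs : t - a ≠ 0 := (sub_pos.2 ht).ne'
  have h1 : HasDerivAt (fun t => t - a) 1 t := (hasDerivAt_id' t).sub_const a
  have h2 := (((h1.fun_inv hs).fun_neg).fun_sub
    ((hasDerivAt_const t (2 * d)).fun_div (h1.fun_pow 3) (pow_ne_zero 3 hs))).add_const e
  refine h2.congr_deriv ?_
  push_cast
  field_simp
  ring

theorem contDiffAt_cuspBarrier (a d e : ℝ) {t : ℝ} (ht : a < t) :
    ContDiffAt ℝ 2 (cuspBarrier a d e) t := by
  have hs : t - a ≠ 0 := (sub_pos.2 ht).ne'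
  have h1 : ContDiffAt ℝ 2 (fun t => t - a) t := contDiffAt_id.sub contDiffAt_const
  exact ((h1.log hs).neg.add (contDiffAt_const.div (h1.pow 2) (pow_ne_zero 2 hs))).add
    (contDiffAt_const.mul contDiffAt_id)

theorem laplacian_cuspBarrier (a d e : ℝ) {z : ℂ} (hz : z ≠ 0) (ht : a < -Real.log ‖z‖) :
    Laplacian.laplacian (fun ζ : ℂ => cuspBarrier a d e (-Real.log ‖ζ‖)) z =
      (1 / (-Real.log ‖z‖ - a) ^ 2 + 6 * d / (-Real.log ‖z‖ - a) ^ 4) / ‖z‖ ^ 2 :=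
  laplacian_radial hz (contDiffAt_cuspBarrier a d e ht)
    ((eventually_gt_nhds ht).mono fun _ h => hasDerivAt_cuspBarrier a d e h)
    (hasDerivAt_deriv_cuspBarrier a d e ht)

theorem cuspBarrier_isLittleO (a d : ℝ) :
    cuspBarrier a d 0 =o[atTop] fun t => t := by
  have hsub : Tendsto (fun t : ℝ => t - a) atTop atTop := tendsto_atTop_add_const_right _ _ tendsto_id
  have hO : (fun t : ℝ => t - a) =O[atTop] fun t => t :=
    (isBigO_refl _ _).sub (isLittleO_const_id_atTop a).isBigO
  have h1 : (fun t => Real.log (t - a)) =o[atTop] fun t : ℝ => t :=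
    (Real.isLittleO_log_id_atTop.comp_tendsto hsub).trans_isBigO hO
  have h2 : (fun t => d / (t - a) ^ 2) =o[atTop] fun t : ℝ => t :=
    (((tendsto_pow_atTop two_ne_zero).comp hsub).const_div_atTop d).isBigO_one ℝ |>.trans_isLittleO
      (isLittleO_const_id_atTop (1 : ℝ))
  refine (h1.neg_left.add h2).congr_left fun t => ?_
  simp [cuspBarrier]

/-- `v` solves `Δv = k e^{2v} / |z|²` in the punctured disc of radius `ρ`. For a solution `u` of the
curvature equation this is the equation of `u + log |z|`. -/
structure IsCuspSolution (k v : ℂ → ℝ) (ρ : ℝ) : Prop where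
  contDiffAt : ∀ z : ℂ, 0 < ‖z‖ → ‖z‖ < ρ → ContDiffAt ℝ 2 v z
  laplacian_eq : ∀ z : ℂ, 0 < ‖z‖ → ‖z‖ < ρ →
    Laplacian.laplacian v z = k z * Real.exp (2 * v z) / ‖z‖ ^ 2

theorem exp_two_mul_neg_log_add {s : ℝ} (hs : 0 < s) (x : ℝ) :
    Real.exp (2 * (-Real.log s + x)) = Real.exp (2 * x) / s ^ 2 := by
  rw [show 2 * (-Real.log s + x) = 2 * x - 2 * Real.log s by ring, Real.exp_sub,
    show 2 * Real.log s = Real.log (s ^ 2) by rw [Real.log_pow]; norm_num,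
    Real.exp_log (by positivity)]

theorem lt_neg_log_norm {a T : ℝ} (ha : a < T) {z : ℂ} (hz : 0 < ‖z‖) (hzT : ‖z‖ ≤ Real.exp (-T)) :
    T ≤ -Real.log ‖z‖ ∧ a < -Real.log ‖z‖ := by
  have := (Real.log_le_iff_le_exp hz).2 hzT
  constructor <;> linarith

theorem le_of_forall_le_add_mul {a b t : ℝ} (ht : 0 < t) (h : ∀ ε > 0, a ≤ b + ε * t) : a ≤ b := by
  refine le_of_forall_pos_le_add fun η hη => ?_
  have := h (η / t) (by positivity)
  rwa [div_mul_cancel₀ _ ht.ne'] at this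

theorem cuspBarrier_eq_add (a d e t : ℝ) : cuspBarrier a d e t = cuspBarrier a d 0 t + e * t := by
  simp [cuspBarrier]

namespace IsCuspSolution

variable {k v : ℂ → ℝ} {ρ : ℝ}

/-- Upper bound: the barrier `-log (t - a) - D / (t - a) ^ 2 + ε t` is a supersolution, and it
dominates `v` near the puncture for every `ε > 0`. -/
theorem le_neg_log (h : IsCuspSolution k v ρ) {T a D : ℝ} (hT : 0 < T) (hTρ : Real.exp (-T) < ρ)
    (ha : a < T) (hD : 0 ≤ D)
    (hk : ∀ z : ℂ, 0 < ‖z‖ → ‖z‖ ≤ Real.exp (-T) →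
      0 < k z ∧ 1 - D / (-Real.log ‖z‖ - a) ^ 2 ≤ k z)
    (hb : ∀ z : ℂ, ‖z‖ = Real.exp (-T) → v z ≤ cuspBarrier a (-D) 0 T)
    (h0 : ∀ ε > 0, ∀ᶠ z in 𝓝[≠] (0 : ℂ), v z ≤ ε * -Real.log ‖z‖)
    {z : ℂ} (hz : 0 < ‖z‖) (hzT : ‖z‖ ≤ Real.exp (-T)) :
    v z ≤ -Real.log (-Real.log ‖z‖ - a) := by
  have htz := lt_neg_log_norm ha hz hzT
  have key : v z ≤ cuspBarrier a (-D) 0 (-Real.log ‖z‖) := by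
    refine le_of_forall_le_add_mul (hT.trans_le htz.1) fun ε hε => ?_
    rw [← cuspBarrier_eq_add]
    have hB : ∀ z : ℂ, 0 < ‖z‖ → ‖z‖ ≤ Real.exp (-T) →
        ContDiffAt ℝ 2 (fun ζ : ℂ => cuspBarrier a (-D) ε (-Real.log ‖ζ‖)) z := fun z hz hzT =>
      contDiffAt_radial (norm_pos_iff.1 hz)
        (contDiffAt_cuspBarrier a (-D) ε (lt_neg_log_norm ha hz hzT).2)
    have := nonpos_of_laplacian_pos_punctured (ρ := Real.exp (-T))
      (f := v - fun ζ : ℂ => cuspBarrier a (-D) ε (-Real.log ‖ζ‖))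
      (fun z hz hzT => (h.contDiffAt z hz (hzT.trans_lt hTρ)).sub (hB z hz hzT)) ?_ ?_ ?_ hz hzT
    · simpa using this
    · intro z hz
      have := hb z hz
      have hε' : 0 < ε * T := by positivity
      simp only [Pi.sub_apply, hz, Real.log_exp, neg_neg]
      rw [cuspBarrier_eq_add]
      linarith
    · filter_upwards [h0 (ε / 2) (by positivity), tendsto_neg_log_norm.eventually
        ((cuspBarrier_isLittleO a (-D)).bound (half_pos hε)),
        tendsto_neg_log_norm.eventually_ge_atTop 0] with z h1 h2 h3
      rw [Real.norm_of_nonneg h3] at h2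
      have := neg_le_of_abs_le h2
      simp only [Pi.sub_apply]
      rw [cuspBarrier_eq_add]
      linarith
    · intro z hz hzT hpos
      obtain ⟨hkpos, hkge⟩ := hk z hz hzT
      have ht := lt_neg_log_norm ha hz hzT
      rw [(h.contDiffAt z hz (hzT.trans_lt hTρ)).laplacian_sub (hB z hz hzT),
        h.laplacian_eq z hz (hzT.trans_lt hTρ),
        laplacian_cuspBarrier a (-D) ε (norm_pos_iff.1 hz) ht.2, ← sub_div]
      refine div_pos ?_ (by positivity)
      set t := -Real.log ‖z‖
      have hs : 0 < t - a := sub_pos.2 ht.2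
      set s := t - a
      set x := D / s ^ 2 with hx
      have hx0 : 0 ≤ x := by positivity
      have hv : -Real.log s + -x < v z := by
        have h1 : 0 < ε * t := mul_pos hε (hT.trans_le ht.1)
        have h2 : cuspBarrier a (-D) ε t < v z := sub_pos.1 hpos
        have h3 : cuspBarrier a (-D) ε t = -Real.log s + -x + ε * t := by
          simp only [cuspBarrier, hx, neg_div, s]
        linarith
      have hexp : Real.exp (2 * -x) / s ^ 2 < Real.exp (2 * v z) := by
        rw [← exp_two_mul_neg_log_add hs]
        exact Real.exp_lt_exp.2 (by linarith)
      -- If `6 x > 1` the left-hand side is negative, and `k ≥ 1 - x` carries no information.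
      have h6 : 1 - 6 * x ≤ k z * Real.exp (2 * -x) := by
        by_cases hx6 : 6 * x ≤ 1
        · have := Real.add_one_le_exp (2 * -x)
          nlinarith [mul_le_mul hkge this (by linarith) hkpos.le]
        · have := mul_pos hkpos (Real.exp_pos (2 * -x))
          linarith
      have e : 1 / s ^ 2 + 6 * -D / s ^ 4 = (1 - 6 * x) / s ^ 2 := by
        rw [hx]; field_simp; ring
      rw [sub_pos, e]
      calc (1 - 6 * x) / s ^ 2 ≤ k z * Real.exp (2 * -x) / s ^ 2 := by gcongr
        _ = k z * (Real.exp (2 * -x) / s ^ 2) := by ring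
        _ < _ := by gcongr
  refine key.trans ?_
  have : 0 ≤ D / (-Real.log ‖z‖ - a) ^ 2 := by positivity
  simp only [cuspBarrier, neg_div]
  linarith

/-- Lower bound: the barrier `-log (t - a) + D / (t - a) ^ 2 - ε t` is a subsolution, and it is
dominated by `v` near the puncture for every `ε > 0`. -/
theorem neg_log_le (h : IsCuspSolution k v ρ) {T a D : ℝ} (hT : 0 < T) (hTρ : Real.exp (-T) < ρ)
    (ha : a < T) (hD : 0 ≤ D)
    (hk : ∀ z : ℂ, 0 < ‖z‖ → ‖z‖ ≤ Real.exp (-T) →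
      0 < k z ∧ k z ≤ 1 + D / (-Real.log ‖z‖ - a) ^ 2 ∧ D / (-Real.log ‖z‖ - a) ^ 2 ≤ 1 / 8)
    (hb : ∀ z : ℂ, ‖z‖ = Real.exp (-T) → cuspBarrier a D 0 T ≤ v z)
    (h0 : ∀ ε > 0, ∀ᶠ z in 𝓝[≠] (0 : ℂ), -(ε * -Real.log ‖z‖) ≤ v z)
    {z : ℂ} (hz : 0 < ‖z‖) (hzT : ‖z‖ ≤ Real.exp (-T)) :
    -Real.log (-Real.log ‖z‖ - a) ≤ v z := by
  have htz := lt_neg_log_norm ha hz hzT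
  have key : cuspBarrier a D 0 (-Real.log ‖z‖) ≤ v z := by
    refine le_of_forall_le_add_mul (hT.trans_le htz.1) fun ε hε => ?_
    rw [← sub_nonpos]
    have hB : ∀ z : ℂ, 0 < ‖z‖ → ‖z‖ ≤ Real.exp (-T) →
        ContDiffAt ℝ 2 (fun ζ : ℂ => cuspBarrier a D (-ε) (-Real.log ‖ζ‖)) z := fun z hz hzT =>
      contDiffAt_radial (norm_pos_iff.1 hz)
        (contDiffAt_cuspBarrier a D (-ε) (lt_neg_log_norm ha hz hzT).2)
    have := nonpos_of_laplacian_pos_punctured (ρ := Real.exp (-T))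
      (f := (fun ζ : ℂ => cuspBarrier a D (-ε) (-Real.log ‖ζ‖)) - v)
      (fun z hz hzT => (hB z hz hzT).sub (h.contDiffAt z hz (hzT.trans_lt hTρ))) ?_ ?_ ?_ hz hzT
    · simp only [Pi.sub_apply] at this
      rw [cuspBarrier_eq_add] at this
      linarith
    · intro z hz
      have := hb z hz
      have hε' : 0 < ε * T := by positivity
      simp only [Pi.sub_apply, hz, Real.log_exp, neg_neg]
      rw [cuspBarrier_eq_add]
      linarith
    · filter_upwards [h0 (ε / 2) (by positivity), tendsto_neg_log_norm.eventually
        ((cuspBarrier_isLittleO a D).bound (half_pos hε)),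
        tendsto_neg_log_norm.eventually_ge_atTop 0] with z h1 h2 h3
      rw [Real.norm_of_nonneg h3] at h2
      have := le_of_abs_le h2
      simp only [Pi.sub_apply]
      rw [cuspBarrier_eq_add]
      linarith
    · intro z hz hzT hpos
      obtain ⟨hkpos, hkle, hx8⟩ := hk z hz hzT
      have ht := lt_neg_log_norm ha hz hzT
      rw [(hB z hz hzT).laplacian_sub (h.contDiffAt z hz (hzT.trans_lt hTρ)),
        h.laplacian_eq z hz (hzT.trans_lt hTρ),
        laplacian_cuspBarrier a D (-ε) (norm_pos_iff.1 hz) ht.2, ← sub_div]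
      refine div_pos ?_ (by positivity)
      set t := -Real.log ‖z‖
      have hs : 0 < t - a := sub_pos.2 ht.2
      set s := t - a
      set x := D / s ^ 2 with hx
      have hx0 : 0 ≤ x := by positivity
      have hv : v z < -Real.log s + x := by
        have h1 : 0 < ε * t := mul_pos hε (hT.trans_le ht.1)
        have h2 : v z < cuspBarrier a D (-ε) t := sub_pos.1 hpos
        have h3 : cuspBarrier a D (-ε) t = -Real.log s + x - ε * t := by
          simp only [cuspBarrier, hx, s]; ring
        linarith
      have hexp : Real.exp (2 * v z) < Real.exp (2 * x) / s ^ 2 := by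
        rw [← exp_two_mul_neg_log_add hs]
        exact Real.exp_lt_exp.2 (by linarith)
      -- `(1 + x) e^{2x} ≤ 1 + 6 x` requires `x` to be small; `x ≤ 1 / 8` is enough.
      have h6 : k z * Real.exp (2 * x) ≤ 1 + 6 * x := by
        have h1 := Real.add_one_le_exp (-(2 * x))
        rw [Real.exp_neg] at h1
        have h2 := Real.exp_pos (2 * x)
        have h3 : (1 - 2 * x) * Real.exp (2 * x) ≤ 1 := by
          have := mul_le_mul_of_nonneg_right h1 h2.le
          rw [inv_mul_cancel₀ h2.ne'] at this
          linarith
        have h4 : 1 + x ≤ (1 + 6 * x) * (1 - 2 * x) := by nlinarith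
        calc k z * Real.exp (2 * x) ≤ (1 + 6 * x) * (1 - 2 * x) * Real.exp (2 * x) := by
              gcongr; linarith
          _ = (1 + 6 * x) * ((1 - 2 * x) * Real.exp (2 * x)) := by ring
          _ ≤ (1 + 6 * x) * 1 := by gcongr
          _ = _ := mul_one _
      have e : 1 / s ^ 2 + 6 * D / s ^ 4 = (1 + 6 * x) / s ^ 2 := by
        rw [hx]; field_simp
      rw [sub_pos, e]
      calc k z * Real.exp (2 * v z) < k z * (Real.exp (2 * x) / s ^ 2) := by gcongr
        _ = k z * Real.exp (2 * x) / s ^ 2 := by ring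
        _ ≤ _ := by gcongr
  refine le_trans ?_ key
  have : 0 ≤ D / (-Real.log ‖z‖ - a) ^ 2 := by positivity
  simp only [cuspBarrier]
  linarith

/-- The circle maxima of a nonpositive solution control its circle minima, by Harnack's inequality
applied to `-v`. -/
theorem eventually_ge_of_exists_ge_on_circle (h : IsCuspSolution k v ρ) {T : ℝ} (hTρ : Real.exp (-T) < ρ)
    (hv : ∀ z : ℂ, 0 < ‖z‖ → ‖z‖ ≤ Real.exp (-T) → v z ≤ 0)
    (hk : ∀ z : ℂ, 0 < ‖z‖ → ‖z‖ ≤ Real.exp (-T) → 0 < k z ∧ k z ≤ 2)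
    (h0 : ∀ ε > 0, ∀ᶠ r in 𝓝[>] (0 : ℝ), ∃ z : ℂ, ‖z‖ = r ∧ -(ε * -Real.log r) ≤ v z)
    {ε : ℝ} (hε : 0 < ε) : ∀ᶠ z in 𝓝[≠] (0 : ℂ), -(ε * -Real.log ‖z‖) ≤ v z := by
  have hr : ∀ᶠ r in 𝓝[>] (0 : ℝ), r < 2 / 3 * Real.exp (-T) :=
    nhdsWithin_le_nhds (eventually_lt_nhds (by positivity))
  filter_upwards [tendsto_norm_nhdsNE_zero.eventually hr,
    tendsto_norm_nhdsNE_zero.eventually (h0 (ε / (2 * 3 ^ 13)) (by positivity)),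
    tendsto_neg_log_norm.eventually_ge_atTop (4 * 3 ^ 13 / ε), self_mem_nhdsWithin]
    with z₁ h1 ⟨z₂, hz₂, h2⟩ h3 hz₁
  have hpos : 0 < ‖z₁‖ := norm_pos_iff.2 hz₁
  have := superharmonic_le_on_circle (N := -v) (B := 2) hpos zero_le_two (fun z hz hz' => ?_) rfl hz₂
  · rw [div_le_iff₀ hε] at h3
    simp only [Pi.neg_apply] at this
    have e : 3 ^ 13 * (ε / (2 * 3 ^ 13) * -Real.log ‖z₁‖) = ε * -Real.log ‖z₁‖ / 2 := by ring
    linarith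
  · have hz0 : 0 < ‖z‖ := by linarith
    have hzT : ‖z‖ ≤ Real.exp (-T) := by linarith
    have hexp : Real.exp (2 * v z) ≤ 1 := Real.exp_le_one_iff.2 (by linarith [hv z hz0 hzT])
    have hkz := hk z hz0 hzT
    have hpr := mul_pos hkz.1 (Real.exp_pos (2 * v z))
    rw [InnerProductSpace.laplacian_neg, Pi.neg_apply, Pi.neg_apply, h.laplacian_eq z hz0 (hzT.trans_lt hTρ)]
    refine ⟨(h.contDiffAt z hz0 (hzT.trans_lt hTρ)).neg, by simpa using hv z hz0 hzT, ?_, ?_⟩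
    · rw [neg_nonpos]; positivity
    · rw [neg_le_neg_iff]
      gcongr
      nlinarith [Real.exp_pos (2 * v z)]

end IsCuspSolution

/-! ### Asymptotics of cusp solutions with Hölder curvature -/

/-- Exponential decay beats `(1 + (t - T))⁻²` uniformly in `t ≥ T`, with a factor
`exp (-ν T / 2)` to spare. -/
theorem mul_exp_neg_le_div_sq {A ν T t : ℝ} (hA : 0 ≤ A) (hν : 0 < ν) (hν1 : ν ≤ 1)
    (hT : 16 * A / ν ^ 2 ≤ Real.exp (ν * T / 2)) (ht : T ≤ t) :
    A * Real.exp (-(ν * t)) ≤ Real.exp (-(ν * T / 2)) / (8 * (1 + (t - T)) ^ 2) := by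
  obtain ⟨τ, hτ, rfl⟩ : ∃ τ, 0 ≤ τ ∧ t = T + τ := ⟨t - T, by linarith, by ring⟩
  rw [add_sub_cancel_left, le_div_iff₀ (by positivity)]
  have h1 : ν ^ 2 * (1 + τ) ^ 2 ≤ 2 * Real.exp (ν * τ) := by
    have h2 := Real.quadratic_le_exp_of_nonneg (mul_nonneg hν.le hτ)
    have h3 : ν * τ * ν ≤ ν * τ * 1 := by gcongr
    nlinarith
  have h2 : (1 + τ) ^ 2 ≤ 2 / ν ^ 2 * Real.exp (ν * τ) := by
    rw [div_mul_eq_mul_div, le_div_iff₀ (by positivity)]; linarith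
  calc A * Real.exp (-(ν * (T + τ))) * (8 * (1 + τ) ^ 2)
      ≤ A * Real.exp (-(ν * (T + τ))) * (8 * (2 / ν ^ 2 * Real.exp (ν * τ))) := by gcongr
    _ = 16 * A / ν ^ 2 * (Real.exp (-(ν * (T + τ))) * Real.exp (ν * τ)) := by ring
    _ = 16 * A / ν ^ 2 * Real.exp (-(ν * T)) := by rw [← Real.exp_add]; ring_nf
    _ ≤ Real.exp (ν * T / 2) * Real.exp (-(ν * T)) := by gcongr
    _ = _ := by rw [← Real.exp_add]; ring_nf

theorem rpow_eq_exp_neg_mul {r : ℝ} (hr : 0 < r) (ν : ℝ) :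
    r ^ ν = Real.exp (-(ν * -Real.log r)) := by
  rw [Real.rpow_def_of_pos hr]; ring_nf

namespace IsCuspSolution

variable {k v : ℂ → ℝ} {ρ : ℝ}

/-- A solution whose circle maxima are `o(log (1 / |z|))` lies between two hyperbolic cusp metrics,
up to translations of `t = -log |z|`. -/
theorem exists_cusp_bounds (h : IsCuspSolution k v ρ) (hρ : 0 < ρ) {A ν : ℝ} (hA : 0 ≤ A)
    (hν : 0 < ν) (hν1 : ν ≤ 1)
    (hk : ∀ z : ℂ, 0 < ‖z‖ → ‖z‖ < ρ → |k z - 1| ≤ A * ‖z‖ ^ ν)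
    (hup : ∀ ε > 0, ∀ᶠ z in 𝓝[≠] (0 : ℂ), v z ≤ ε * -Real.log ‖z‖)
    (hlow : ∀ ε > 0, ∀ᶠ r in 𝓝[>] (0 : ℝ), ∃ z : ℂ, ‖z‖ = r ∧ -(ε * -Real.log r) ≤ v z) :
    ∃ T b : ℝ, 0 < T ∧ 0 < b ∧ Real.exp (-T) < ρ ∧ ∀ z : ℂ, 0 < ‖z‖ → ‖z‖ < Real.exp (-T) →
      -Real.log (-Real.log ‖z‖ - T + b) ≤ v z ∧ v z ≤ -Real.log (-Real.log ‖z‖ - T) := by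
  have hexp0 : Tendsto (fun T : ℝ => Real.exp (-T)) atTop (𝓝 0) :=
    Real.tendsto_exp_neg_atTop_nhds_zero
  have hcirc : ∀ᶠ T : ℝ in atTop, ∀ z : ℂ, ‖z‖ = Real.exp (-T) → v z ≤ ν / 8 * T := by
    obtain ⟨δ, hδ, hδv⟩ := Metric.eventually_nhds_iff.1
      (eventually_nhdsWithin_iff.1 (hup (ν / 8) (by positivity)))
    filter_upwards [hexp0.eventually_lt_const hδ] with T hT z hz
    have := hδv (y := z) (by simpa [hz] using hT) (by
      rw [mem_compl_singleton_iff, ← norm_pos_iff, hz]; positivity)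
    rwa [hz, Real.log_exp, neg_neg] at this
  have hbig : Tendsto (fun T : ℝ => Real.exp (ν * T / 2)) atTop atTop :=
    Real.tendsto_exp_atTop.comp ((tendsto_id.const_mul_atTop hν).atTop_div_const two_pos)
  obtain ⟨T, hT0, hTρ, hTA, hT8, hTv⟩ := ((eventually_gt_atTop (0 : ℝ)).and
    ((hexp0.eventually_lt_const hρ).and ((hbig.eventually_ge_atTop (16 * A / ν ^ 2)).and
    ((eventually_ge_atTop (8 / ν)).and hcirc)))).exists
  have hk' : ∀ z : ℂ, 0 < ‖z‖ → ‖z‖ ≤ Real.exp (-T) → T ≤ -Real.log ‖z‖ ∧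
      |k z - 1| ≤ Real.exp (-(ν * T / 2)) / (8 * (1 + (-Real.log ‖z‖ - T)) ^ 2) := by
    intro z hz hzT
    have ht := (lt_neg_log_norm (sub_one_lt T) hz hzT).1
    refine ⟨ht, (hk z hz (hzT.trans_lt hTρ)).trans ?_⟩
    rw [rpow_eq_exp_neg_mul hz]
    exact mul_exp_neg_le_div_sq hA hν hν1 hTA ht
  have hexp1 : Real.exp (-(ν * T / 2)) ≤ 1 := by
    rw [Real.exp_le_one_iff]; have := mul_pos hν hT0; linarith
  have hk8 : ∀ z : ℂ, 0 < ‖z‖ → ‖z‖ ≤ Real.exp (-T) →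
      |k z - 1| ≤ 1 / (8 * (1 + (-Real.log ‖z‖ - T)) ^ 2) := fun z hz hzT =>
    (hk' z hz hzT).2.trans (by gcongr)
  have hk1 : ∀ z : ℂ, 0 < ‖z‖ → ‖z‖ ≤ Real.exp (-T) → 0 < k z ∧ k z ≤ 2 := by
    intro z hz hzT
    have h1 : (1 : ℝ) / (8 * (1 + (-Real.log ‖z‖ - T)) ^ 2) ≤ 1 / (8 * 1 ^ 2) := by
      have := (hk' z hz hzT).1
      gcongr
      linarith
    have := abs_le.1 ((hk8 z hz hzT).trans h1)
    constructor <;> linarith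
  -- The width `s₀ = exp (-ν T / 4)` makes the barrier on `|z| = exp (-T)` as large as `ν T / 4 - 1`,
  -- which dominates the bound `ν T / 8` known for `v` there.
  set s₀ : ℝ := Real.exp (-(ν * T / 4)) with hs₀
  have hs₀pos : 0 < s₀ := Real.exp_pos _
  have hs₀1 : s₀ ≤ 1 := by
    rw [hs₀, Real.exp_le_one_iff]; have := mul_pos hν hT0; linarith
  have hs₀sq : Real.exp (-(ν * T / 2)) = s₀ ^ 2 := by
    rw [hs₀, ← Real.exp_nat_mul]; congr 1; push_cast; ring
  have hupper : ∀ z : ℂ, 0 < ‖z‖ → ‖z‖ ≤ Real.exp (-T) →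
      v z ≤ -Real.log (-Real.log ‖z‖ - (T - s₀)) := by
    intro z hz hzT
    refine h.le_neg_log hT0 hTρ (sub_lt_self T hs₀pos) (sq_nonneg s₀) (fun z hz hzT => ?_)
      (fun z hz => ?_) hup hz hzT
    · refine ⟨(hk1 z hz hzT).1, ?_⟩
      obtain ⟨ht, hkz⟩ := hk' z hz hzT
      have h1 : Real.exp (-(ν * T / 2)) / (8 * (1 + (-Real.log ‖z‖ - T)) ^ 2) ≤
          s₀ ^ 2 / (-Real.log ‖z‖ - (T - s₀)) ^ 2 := by
        rw [hs₀sq]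
        have h2 : 0 < -Real.log ‖z‖ - (T - s₀) := by linarith
        have h3 : (-Real.log ‖z‖ - (T - s₀)) ^ 2 ≤ (1 + (-Real.log ‖z‖ - T)) ^ 2 := by
          gcongr; linarith
        gcongr
        nlinarith [sq_nonneg (1 + (-Real.log ‖z‖ - T))]
      have := (abs_le.1 (hkz.trans h1)).1
      linarith
    · have h1 := hTv z hz
      have h2 : cuspBarrier (T - s₀) (-s₀ ^ 2) 0 T = ν * T / 4 - 1 := by
        simp only [cuspBarrier, sub_sub_cancel]
        rw [neg_div, div_self (by positivity), hs₀, Real.log_exp]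
        ring
      rw [h2]
      rw [div_le_iff₀ hν] at hT8
      linarith
  have hvneg : ∀ z : ℂ, 0 < ‖z‖ → ‖z‖ ≤ Real.exp (-(T + 1)) → v z ≤ 0 := by
    intro z hz hzT
    have hle : Real.exp (-(T + 1)) ≤ Real.exp (-T) := Real.exp_le_exp.2 (by linarith)
    refine (hupper z hz (hzT.trans hle)).trans ?_
    have := (lt_neg_log_norm (lt_add_one T) hz hzT).1
    have := Real.log_nonneg (x := -Real.log ‖z‖ - (T - s₀)) (by linarith)
    linarith
  have hlower0 : ∀ ε > 0, ∀ᶠ z in 𝓝[≠] (0 : ℂ), -(ε * -Real.log ‖z‖) ≤ v z := fun ε hε => by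
    have hle : Real.exp (-(T + 1)) ≤ Real.exp (-T) := Real.exp_le_exp.2 (by linarith)
    exact h.eventually_ge_of_exists_ge_on_circle (hle.trans_lt hTρ) hvneg
      (fun z hz hzT => hk1 z hz (hzT.trans hle)) hlow hε
  obtain ⟨m, hm⟩ : ∃ m : ℝ, ∀ z : ℂ, ‖z‖ = Real.exp (-T) → m ≤ v z := by
    have hc : ContinuousOn v (Metric.sphere 0 (Real.exp (-T))) := fun z hz => by
      have hz' : ‖z‖ = Real.exp (-T) := by simpa using hz
      exact (h.contDiffAt z (by rw [hz']; positivity)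
        (by rwa [hz'])).continuousAt.continuousWithinAt
    obtain ⟨m, hm⟩ := (isCompact_sphere (0 : ℂ) (Real.exp (-T))).bddBelow_image hc
    exact ⟨m, fun z hz => hm ⟨z, by simpa using hz, rfl⟩⟩
  -- A large width `b` makes the lower barrier small on `|z| = exp (-T)`.
  set b : ℝ := max 1 (Real.exp (1 / 8 - m)) with hb
  have hb1 : 1 ≤ b := le_max_left _ _
  have hbpos : 0 < b := by linarith
  have hlower : ∀ z : ℂ, 0 < ‖z‖ → ‖z‖ ≤ Real.exp (-T) →
      -Real.log (-Real.log ‖z‖ - (T - b)) ≤ v z := by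
    intro z hz hzT
    refine h.neg_log_le hT0 hTρ (sub_lt_self T hbpos) (D := b ^ 2 / 8) (by positivity)
      (fun z hz hzT => ?_) (fun z hz => ?_) hlower0 hz hzT
    · obtain ⟨ht, -⟩ := hk' z hz hzT
      have hkz := hk8 z hz hzT
      set τ := -Real.log ‖z‖ - T with hτ
      have hτ0 : 0 ≤ τ := by linarith
      have hs : -Real.log ‖z‖ - (T - b) = τ + b := by rw [hτ]; ring
      rw [hs]
      refine ⟨(hk1 z hz hzT).1, ?_, ?_⟩
      · have h1 : 1 / (8 * (1 + τ) ^ 2) ≤ b ^ 2 / 8 / (τ + b) ^ 2 := by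
          rw [div_div, div_le_div_iff₀ (by positivity) (by positivity)]
          have h2 : (τ + b) ^ 2 ≤ (b * (1 + τ)) ^ 2 := by
            gcongr; nlinarith
          nlinarith
        have := (abs_le.1 (hkz.trans h1)).2
        linarith
      · rw [div_div, div_le_div_iff₀ (by positivity) (by positivity)]
        have h2 : b ^ 2 ≤ (τ + b) ^ 2 := by gcongr; linarith
        linarith
    · refine le_trans ?_ (hm z hz)
      have h1 : 1 / 8 - m ≤ Real.log b := by
        rw [Real.le_log_iff_exp_le hbpos]; exact le_max_right _ _
      have h2 : cuspBarrier (T - b) (b ^ 2 / 8) 0 T = -Real.log b + 1 / 8 := by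
        simp only [cuspBarrier, sub_sub_cancel]
        field_simp
        ring
      rw [h2]
      linarith
  refine ⟨T, b, hT0, hbpos, hTρ, fun z hz hzT => ⟨?_, ?_⟩⟩
  · have := hlower z hz hzT.le
    rwa [← sub_add] at this
  · refine (hupper z hz hzT.le).trans (neg_le_neg (Real.log_le_log ?_ (by linarith)))
    have := (Real.log_lt_iff_lt_exp hz).2 hzT
    linarith

/-- The density of a cusp solution agrees with the hyperbolic one up to a relative error
`O(1 / log (1 / |z|))`. -/
theorem exists_abs_density_sub_one_le (h : IsCuspSolution k v ρ) (hρ : 0 < ρ) {A ν : ℝ}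
    (hA : 0 ≤ A) (hν : 0 < ν) (hν1 : ν ≤ 1)
    (hk : ∀ z : ℂ, 0 < ‖z‖ → ‖z‖ < ρ → |k z - 1| ≤ A * ‖z‖ ^ ν)
    (hup : ∀ ε > 0, ∀ᶠ z in 𝓝[≠] (0 : ℂ), v z ≤ ε * -Real.log ‖z‖)
    (hlow : ∀ ε > 0, ∀ᶠ r in 𝓝[>] (0 : ℝ), ∃ z : ℂ, ‖z‖ = r ∧ -(ε * -Real.log r) ≤ v z) :
    ∃ B : ℝ, ∀ᶠ z in 𝓝[≠] (0 : ℂ),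
      |k z * Real.exp (2 * v z) * (-Real.log ‖z‖) ^ 2 - 1| ≤ B / -Real.log ‖z‖ := by
  obtain ⟨T, b, hT, hb, hTρ, hv⟩ := h.exists_cusp_bounds hρ hA hν hν1 hk hup hlow
  refine ⟨4 * A / ν + (8 * T + 2 * b), ?_⟩
  filter_upwards [tendsto_neg_log_norm.eventually_ge_atTop (2 * T), self_mem_nhdsWithin]
    with z ht hz0
  have hz : 0 < ‖z‖ := norm_pos_iff.2 hz0
  have hzT : ‖z‖ < Real.exp (-T) := (Real.log_lt_iff_lt_exp hz).1 (by linarith)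
  obtain ⟨h1, h2⟩ := hv z hz hzT
  have h3 := hk z hz (hzT.trans hTρ)
  rw [rpow_eq_exp_neg_mul hz] at h3
  set t := -Real.log ‖z‖
  have ht0 : 0 < t := by linarith
  have htT : 0 < t - T := by linarith
  have htb : 0 < t - T + b := by linarith
  have hE1 : Real.exp (2 * v z) ≤ 1 / (t - T) ^ 2 := by
    have := exp_two_mul_neg_log_add htT 0
    rw [mul_zero, Real.exp_zero] at this
    rw [← this]
    exact Real.exp_le_exp.2 (by linarith)
  have hE2 : 1 / (t - T + b) ^ 2 ≤ Real.exp (2 * v z) := by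
    have := exp_two_mul_neg_log_add htb 0
    rw [mul_zero, Real.exp_zero] at this
    rw [← this]
    exact Real.exp_le_exp.2 (by linarith)
  set E := Real.exp (2 * v z) * t ^ 2 with hE
  have hEpos : 0 < E := by positivity
  have hE4 : E ≤ 4 := by
    calc E ≤ 1 / (t - T) ^ 2 * t ^ 2 := mul_le_mul_of_nonneg_right hE1 (sq_nonneg t)
      _ ≤ 4 := by
        rw [one_div_mul_eq_div, div_le_iff₀ (by positivity)]
        nlinarith
  have hEup : E - 1 ≤ 8 * T / t := by
    have : E ≤ 1 / (t - T) ^ 2 * t ^ 2 := mul_le_mul_of_nonneg_right hE1 (sq_nonneg t)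
    have h5 : 1 / (t - T) ^ 2 * t ^ 2 ≤ 1 + 8 * T / t := by
      have e : 1 + 8 * T / t = (t + 8 * T) / t := by field_simp
      rw [one_div_mul_eq_div, e, div_le_div_iff₀ (by positivity) ht0]
      nlinarith [mul_nonneg hT.le (sub_nonneg.2 ht), mul_nonneg hT.le (mul_nonneg hT.le
        (sub_nonneg.2 ht)), mul_nonneg hT.le (sq_nonneg (t - 2 * T)), pow_pos hT 3]
    linarith
  have hElow : -(2 * b / t) ≤ E - 1 := by
    have h4 : 1 / (t + b) ^ 2 * t ^ 2 ≤ E := by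
      refine le_trans ?_ (mul_le_mul_of_nonneg_right hE2 (sq_nonneg t))
      gcongr
      linarith
    have h5 : 1 - 2 * b / t ≤ 1 / (t + b) ^ 2 * t ^ 2 := by
      have e : 1 - 2 * b / t = (t - 2 * b) / t := by field_simp
      rw [one_div_mul_eq_div, e, div_le_div_iff₀ ht0 (by positivity)]
      nlinarith [mul_pos ht0 (pow_pos hb 2), pow_pos hb 3]
    linarith
  have hEabs : |E - 1| ≤ (8 * T + 2 * b) / t := by
    have : 0 ≤ 8 * T / t := by positivity
    have : 0 ≤ 2 * b / t := by positivity
    rw [add_div, abs_le]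
    constructor <;> linarith
  have hdecay : A * Real.exp (-(ν * t)) ≤ A / ν / t := by
    rw [Real.exp_neg, div_div, div_eq_mul_inv]
    have := Real.add_one_le_exp (ν * t)
    have : 0 < ν * t := by positivity
    gcongr
    linarith
  calc |k z * Real.exp (2 * v z) * t ^ 2 - 1| = |(k z - 1) * E + (E - 1)| := by
        rw [hE]; ring_nf
    _ ≤ |k z - 1| * E + |E - 1| := by
        refine (abs_add_le _ _).trans ?_
        rw [abs_mul, abs_of_pos hEpos]
    _ ≤ A / ν / t * 4 + (8 * T + 2 * b) / t := by
        have := h3.trans hdecay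
        gcongr
    _ = _ := by ring

end IsCuspSolution

/-! ### Solutions of the curvature equation of order one -/

theorem isOpen_puncturedDisk : IsOpen puncturedDisk := Metric.isOpen_ball.sdiff isClosed_singleton

theorem mem_puncturedDisk {z : ℂ} : z ∈ puncturedDisk ↔ ‖z‖ < 1 ∧ z ≠ 0 := by
  simp [puncturedDisk, unitDisk]

theorem isGreatest_circleSup {u : ℂ → ℝ} (hu : ContinuousOn u puncturedDisk) {r : ℝ} (hr : 0 < r)
    (hr1 : r < 1) : IsGreatest (u '' Metric.sphere 0 r) (circleSup u r) := by
  have hsub : Metric.sphere (0 : ℂ) r ⊆ puncturedDisk := fun z hz => by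
    have hz' : ‖z‖ = r := by simpa using hz
    exact mem_puncturedDisk.2 ⟨by linarith, by rw [← norm_pos_iff]; linarith⟩
  have hne : (Metric.sphere (0 : ℂ) r).Nonempty := NormedSpace.sphere_nonempty.2 hr.le
  exact ((isCompact_sphere 0 r).image_of_continuousOn (hu.mono hsub)).isGreatest_sSup
    (hne.image u)

/-- The normalisation `v = u + log |z| + log c / 2`, `k = -κ / c` with `c = -κ 0` turns a solution of
the curvature equation into a cusp solution whose curvature factor tends to `1`. -/
theorem IsCurvatureSolution.isCuspSolution {κ u : ℂ → ℝ} (hu : IsCurvatureSolution κ u) {c : ℝ}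
    (hc : 0 < c) {ρ : ℝ} (hρ : ρ ≤ 1) :
    IsCuspSolution (fun z => -κ z / c) (fun z => u z + Real.log ‖z‖ + Real.log c / 2) ρ := by
  have hC : ∀ z ∈ puncturedDisk, ContDiffAt ℝ 2 u z := fun z hz =>
    hu.1.contDiffAt (isOpen_puncturedDisk.mem_nhds hz)
  have hmem : ∀ z : ℂ, 0 < ‖z‖ → ‖z‖ < ρ → z ∈ puncturedDisk := fun z hz hzρ =>
    mem_puncturedDisk.2 ⟨hzρ.trans_le hρ, norm_pos_iff.1 hz⟩
  refine ⟨fun z hz hzρ => ((hC z (hmem z hz hzρ)).add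
    (contDiffAt_log_norm (norm_pos_iff.1 hz))).add contDiffAt_const, fun z hz hzρ => ?_⟩
  have h1 := hC z (hmem z hz hzρ)
  have h2 := contDiffAt_log_norm (norm_pos_iff.1 hz)
  have h3 : Laplacian.laplacian (fun ζ : ℂ => Real.log ‖ζ‖) z = 0 :=
    (AnalyticAt.harmonicAt_log_norm (f := fun ζ : ℂ => ζ) analyticAt_id
      (norm_pos_iff.1 hz)).2.self_of_nhds
  have h4 : Laplacian.laplacian
      ((u + fun ζ : ℂ => Real.log ‖ζ‖) + fun _ => Real.log c / 2 : ℂ → ℝ) z = Laplacian.laplacian u z := by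
    rw [ContDiffAt.laplacian_add (f₁ := u + fun ζ : ℂ => Real.log ‖ζ‖) (h1.add h2) contDiffAt_const,
      h1.laplacian_add h2, h3, InnerProductSpace.laplacian_const]
    simp
  refine h4.trans ?_
  rw [hu.2 z (hmem z hz hzρ), show 2 * (u z + Real.log ‖z‖ + Real.log c / 2) =
    2 * u z + (Real.log ‖z‖ + Real.log ‖z‖) + Real.log c by ring, Real.exp_add, Real.exp_add,
    Real.exp_add, Real.exp_log hz, Real.exp_log hc]
  field_simp

theorem LocallyHolderOn.exists_abs_sub_le_rpow {κ : ℂ → ℝ} (hκ : LocallyHolderOn κ unitDisk) :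
    ∃ C ν ρ : ℝ, 0 ≤ C ∧ 0 < ν ∧ ν ≤ 1 ∧ 0 < ρ ∧ ρ ≤ 1 ∧
      ∀ z : ℂ, ‖z‖ < ρ → |κ z - κ 0| ≤ C * ‖z‖ ^ ν := by
  have h0 : (0 : ℂ) ∈ unitDisk := Metric.mem_ball_self one_pos
  obtain ⟨C, ν, hν, hν1, U, hU, hκU⟩ := hκ 0 h0
  rw [IsOpen.nhdsWithin_eq (s := unitDisk) Metric.isOpen_ball h0] at hU
  obtain ⟨ρ, hρ, hρU⟩ := Metric.mem_nhds_iff.1 hU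
  refine ⟨C, ν, min ρ 1, C.2, by exact_mod_cast hν, by exact_mod_cast hν1, lt_min hρ one_pos,
    min_le_right _ _, fun z hz => ?_⟩
  have hzU : z ∈ U := hρU (by simpa using hz.trans_le (min_le_left _ _))
  have := hκU.dist_le hzU (mem_of_mem_nhds hU)
  rwa [Real.dist_eq, dist_zero_right] at this

theorem HasOrderAtZero.eventually_abs_circleSup_sub_le {u : ℂ → ℝ} (h : HasOrderAtZero u 1) {ε : ℝ}
    (hε : 0 < ε) :
    ∀ᶠ r in 𝓝[>] (0 : ℝ), |circleSup u r - -Real.log r| ≤ ε * -Real.log r := by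
  have hlog : Tendsto (fun r : ℝ => -Real.log r) (𝓝[>] 0) atTop :=
    tendsto_neg_atBot_atTop.comp Real.tendsto_log_nhdsGT_zero
  filter_upwards [(Metric.tendsto_nhds.1 h) ε hε, hlog.eventually_gt_atTop 0] with r hr hr0
  rw [one_div, Real.log_inv, Real.dist_eq, div_sub_one hr0.ne', abs_div, abs_of_pos hr0,
    div_lt_iff₀ hr0] at hr
  exact hr.le

theorem mainTheorem3 (κ u w : ℂ → ℝ)
    (hκ : LocallyHolderOn κ unitDisk) (hκ0 : κ 0 < 0)
    (hu : IsCurvatureSolution κ u) (horder : HasOrderAtZero u 1)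
    (hw : ∀ z ∈ puncturedDisk,
      u z = -Real.log ‖z‖ - Real.log (Real.log (1 / ‖z‖)) + w z) :
    (fun z : ℂ => mixedDeriv w z) =O[𝓝[≠] (0 : ℂ)]
      (fun z : ℂ => ‖z‖ ^ (-2 : ℤ) * Real.log (1 / ‖z‖) ^ (-3 : ℤ)) := by
  obtain ⟨C, ν, ρ, hC, hν, hν1, hρ, hρ1, hκC⟩ := hκ.exists_abs_sub_le_rpow
  set c : ℝ := -κ 0 with hc
  have hcpos : 0 < c := neg_pos.2 hκ0
  have hsol := hu.isCuspSolution hcpos hρ1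
  have hk : ∀ z : ℂ, 0 < ‖z‖ → ‖z‖ < ρ → |-κ z / c - 1| ≤ C / c * ‖z‖ ^ ν := fun z _ hz => by
    have e : -κ z / c - 1 = -(κ z - κ 0) / c := by
      rw [div_sub_one hcpos.ne', hc]; ring
    rw [e, abs_div, abs_neg, abs_of_pos hcpos, div_mul_eq_mul_div]
    gcongr
    exact hκC z hz
  have hlt1 : ∀ᶠ r in 𝓝[>] (0 : ℝ), r < 1 := nhdsWithin_le_nhds (eventually_lt_nhds one_pos)
  have hlog : Tendsto (fun r : ℝ => -Real.log r) (𝓝[>] 0) atTop :=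
    tendsto_neg_atBot_atTop.comp Real.tendsto_log_nhdsGT_zero
  -- The constant `log c / 2` is absorbed in half of the error `ε log (1 / r)`.
  have hconst : ∀ ε > 0, ∀ᶠ r in 𝓝[>] (0 : ℝ), |Real.log c / 2| ≤ ε / 2 * -Real.log r :=
    fun ε hε => (hlog.const_mul_atTop (half_pos hε)).eventually_ge_atTop _
  have hup : ∀ ε > 0, ∀ᶠ z in 𝓝[≠] (0 : ℂ),
      u z + Real.log ‖z‖ + Real.log c / 2 ≤ ε * -Real.log ‖z‖ := fun ε hε => by
    refine (tendsto_norm_nhdsNE_zero.eventually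
      ((horder.eventually_abs_circleSup_sub_le (half_pos hε)).and
        ((hconst ε hε).and (hlt1.and self_mem_nhdsWithin)))).mono ?_
    rintro z ⟨h1, h2, h3, h4⟩
    have h5 : u z ≤ circleSup u ‖z‖ :=
      (isGreatest_circleSup hu.1.continuousOn h4 h3).2 ⟨z, by simp, rfl⟩
    have := (abs_le.1 h1).2
    have := (abs_le.1 h2).2
    linarith
  have hlow : ∀ ε > 0, ∀ᶠ r in 𝓝[>] (0 : ℝ), ∃ z : ℂ, ‖z‖ = r ∧
      -(ε * -Real.log r) ≤ u z + Real.log ‖z‖ + Real.log c / 2 := fun ε hε => by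
    filter_upwards [horder.eventually_abs_circleSup_sub_le (half_pos hε), hconst ε hε, hlt1,
      self_mem_nhdsWithin] with r h1 h2 h3 h4
    obtain ⟨z, hz, hzu⟩ := (isGreatest_circleSup hu.1.continuousOn h4 h3).1
    have hzr : ‖z‖ = r := by simpa using hz
    refine ⟨z, hzr, ?_⟩
    have := (abs_le.1 h1).1
    have := (abs_le.1 h2).1
    rw [hzu, hzr]
    linarith
  obtain ⟨B, hB⟩ := hsol.exists_abs_density_sub_one_le hρ (by positivity) hν hν1 hk hup hlow
  refine IsBigO.of_bound (B / 4) ?_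
  filter_upwards [hB, self_mem_nhdsWithin, tendsto_neg_log_norm.eventually_gt_atTop 0,
    nhdsWithin_le_nhds (Metric.ball_mem_nhds (0 : ℂ) hρ)] with z hBz hz0 ht hzρ
  have hz : 0 < ‖z‖ := norm_pos_iff.2 hz0
  have hz1 : z ∈ puncturedDisk := mem_puncturedDisk.2
    ⟨(by simpa using hzρ : ‖z‖ < ρ).trans_le hρ1, hz0⟩
  set V : ℂ → ℝ := fun z => u z + Real.log ‖z‖ + Real.log c / 2 with hV
  have hVz := hsol.contDiffAt z hz (by simpa using hzρ)
  have hSz := contDiffAt_radial hz0 (contDiffAt_cuspBarrier 0 0 0 ht)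
  -- Up to a constant, `w` is the difference of the normalised solution and the hyperbolic barrier.
  have hwV : w =ᶠ[𝓝 z] (V - fun ζ : ℂ => cuspBarrier 0 0 0 (-Real.log ‖ζ‖)) -
      fun _ => Real.log c / 2 := by
    filter_upwards [isOpen_puncturedDisk.mem_nhds hz1] with ζ hζ
    have := hw ζ hζ
    rw [one_div, Real.log_inv] at this
    simp only [Pi.sub_apply, hV, cuspBarrier, sub_zero, zero_div, zero_mul, add_zero]
    linarith
  have hD : ContDiffAt ℝ 2 (V - fun ζ : ℂ => cuspBarrier 0 0 0 (-Real.log ‖ζ‖)) z := hVz.sub hSz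
  have hwz : ContDiffAt ℝ 2 w z := (hD.sub contDiffAt_const).congr_of_eventuallyEq hwV
  have hΔw : Laplacian.laplacian w z =
      (-κ z / c * Real.exp (2 * V z) * (-Real.log ‖z‖) ^ 2 - 1) /
        (‖z‖ ^ 2 * (-Real.log ‖z‖) ^ 2) := by
    rw [(InnerProductSpace.laplacian_congr_nhds hwV).self_of_nhds,
      hD.laplacian_sub contDiffAt_const, hVz.laplacian_sub hSz,
      InnerProductSpace.laplacian_const, hsol.laplacian_eq z hz (by simpa using hzρ),
      laplacian_cuspBarrier 0 0 0 hz0 ht]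
    simp only [sub_zero, mul_zero, zero_div, add_zero, Pi.zero_apply]
    generalize -Real.log ‖z‖ = t at ht ⊢
    field_simp
  rw [mixedDeriv_eq_laplacian hwz, Complex.norm_real, hΔw, one_div, Real.log_inv]
  set t := -Real.log ‖z‖
  rw [Real.norm_eq_abs, Real.norm_eq_abs, abs_div, abs_div,
    abs_of_pos (by positivity : 0 < ‖z‖ ^ 2 * t ^ 2), abs_of_pos (by norm_num : (0 : ℝ) < 4),
    abs_of_pos (by positivity : 0 < ‖z‖ ^ (-2 : ℤ) * t ^ (-3 : ℤ))]
  calc _ ≤ B / t / (‖z‖ ^ 2 * t ^ 2) / 4 := by gcongr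
    _ = B / 4 * (‖z‖ ^ (-2 : ℤ) * t ^ (-3 : ℤ)) := by
      simp only [zpow_neg]
      norm_cast
      field_simp
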